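/- All graphs are finite, simple and connected; $d$ is the combinatorial distance, $S_k(x)=\{v: d(x,v)=k\}$, $B_k(x)=\{v: d(x,v)\le k\}$, and $[x,y]=\{v: d(x,v)+d(v,y)=d(x,y)\}$. A vertex $y\neq x$ of a graph $H$ is an antipole of $x$ with respect to $H$ if $d_H(x,y)=\operatorname{diam}(H)$; a pole is a vertex that has an antipole. For a $D$-regular graph $G=(V,E)$ let $\mu_x$ be the uniform probability distribution on $B_1(x)$, let $W_1(\mu,\nu)=\inf_\pi\sum_{x,y}d(x,y)\pi(x,y)$, the infimum over all transport plans $\pi:V\times V\to[0,1]$ with marginals $\mu$ and $\nu$, and for an edge $x\sim y$ let $\kappa(x,y)=\frac{D+1}{D}\bigl(1-W_1(\mu_x,\mu_y)\bigr)$. The graph $G$ is Bonnet-Myers sharp if $K=\inf_{x\sim y}\kappa(x,y)>0$ and $\operatorname{diam}(G)=2/K$. A good optimal transport map $T:B_1(x)\to B_1(y)$ is a bijection such that the plan moving mass $\frac1{D+1}$ from $v$ to $T(v)$ for each $v\in B_1(x)$ attains the infimum $W_1(\mu_x,\mu_y)$, and such that, for $v\in B_1(x)$, $T(v)=v$ if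 and only if $v\in B_1(x)\cap B_1(y)$. **Theorem.** Let $G$ be a $D$-regular Bonnet-Myers sharp graph, let $x_0$ be a pole of $G$, and let $x_0\sim x_1\sim x_2$ be a geodesic (so $d(x_0,x_2)=2$). Let $T_1:B_1(x_0)\to B_1(x_1)$ and $T_2:B_1(x_1)\to B_1(x_2)$ be good optimal transport maps. Let $u\in S_1(x_0)$, $v=T_1(u)$ and $w=T_2(v)$, and assume that $u,v,w$ are all different. Then $w\in S_3(x_0)$, both $u$ and $x_2$ lie in $[x_0,w]$, and $d(u,x_2)=3$. Moreover, $u$ and $x_2$ are antipoles of each other with respect to the subgraph of $G$ induced on $[x_0,w]$. -/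

import Mathlib

noncomputable section

namespace BonnetMyers

variable {V : Type*}

/-- The closed ball `B_k(x) = {v : d(x,v) ≤ k}` of a graph. -/
def ball (G : SimpleGraph V) (k : ℕ) (x : V) : Set V := {v | G.dist x v ≤ k}

/-- The sphere `S_k(x) = {v : d(x,v) = k}` of a graph. -/
def sphere (G : SimpleGraph V) (k : ℕ) (x : V) : Set V := {v | G.dist x v = k}

/-- The interval `[x,y]`: all vertices lying on geodesics from `x` to `y`. -/
def interval (G : SimpleGraph V) (x y : V) : Set V :=
  {v | G.dist x v + G.dist v y = G.dist x y}

/-- `y` is an antipole of `x` with respect to `G`: another vertex at distance `diam G`. -/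
def IsAntipole (G : SimpleGraph V) (x y : V) : Prop := y ≠ x ∧ G.dist x y = G.diam

/-- `x` is a pole of `G`: it has an antipole. -/
def IsPole (G : SimpleGraph V) (x : V) : Prop := ∃ y, IsAntipole G x y

/-- `u` and `v`, both in the vertex set `A`, are antipoles of each other with respect to the
induced subgraph on `A`. -/
def AreAntipolesIn (G : SimpleGraph V) (A : Set V) (u v : V) : Prop :=
  ∃ (hu : u ∈ A) (hv : v ∈ A),
    IsAntipole (G.induce A) ⟨u, hu⟩ ⟨v, hv⟩ ∧ IsAntipole (G.induce A) ⟨v, hv⟩ ⟨u, hu⟩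

/-- `π` is a transport plan from `μ₁` to `μ₂`: a `[0,1]`-valued function on `V × V` with
marginals `μ₁` and `μ₂`. -/
structure IsTransportPlan [Fintype V] (μ₁ μ₂ : V → ℝ) (π : V → V → ℝ) : Prop where
  mem_Icc : ∀ x y, π x y ∈ Set.Icc (0 : ℝ) 1
  left_marginal : ∀ x, μ₁ x = ∑ y, π x y
  right_marginal : ∀ y, μ₂ y = ∑ x, π x y

/-- The cost of a transport plan. -/
def cost [Fintype V] (G : SimpleGraph V) (π : V → V → ℝ) : ℝ :=
  ∑ x, ∑ y, (G.dist x y : ℝ) * π x y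

/-- The Wasserstein distance `W₁(μ₁, μ₂)`. -/
def W1 [Fintype V] (G : SimpleGraph V) (μ₁ μ₂ : V → ℝ) : ℝ :=
  sInf {c | ∃ π, IsTransportPlan μ₁ μ₂ π ∧ c = cost G π}

/-- `π` is an optimal transport plan from `μ₁` to `μ₂`. -/
def IsOptimalTransportPlan [Fintype V] (G : SimpleGraph V) (μ₁ μ₂ : V → ℝ)
    (π : V → V → ℝ) : Prop :=
  IsTransportPlan μ₁ μ₂ π ∧ cost G π = W1 G μ₁ μ₂

/-- The uniform distribution `μ_x` on `B_1(x)` in a `D`-regular graph. -/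
def mu (G : SimpleGraph V) (D : ℕ) (x : V) : V → ℝ :=
  (ball G 1 x).indicator (fun _ => 1 / ((D : ℝ) + 1))

/-- The Ollivier Ricci curvature `κ(x,y)` of an edge of a `D`-regular graph. -/
def kappa [Fintype V] (G : SimpleGraph V) (D : ℕ) (x y : V) : ℝ :=
  ((D : ℝ) + 1) / D * (1 - W1 G (mu G D x) (mu G D y))

/-- The infimum of the Ollivier Ricci curvature over all edges of a `D`-regular graph. -/
def curvatureInf [Fintype V] (G : SimpleGraph V) (D : ℕ) : ℝ :=
  sInf {c | ∃ x y, G.Adj x y ∧ c = kappa G D x y}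

/-- `G` is a `D`-regular Bonnet-Myers sharp graph: finite, connected, `D`-regular, with
`K = inf κ > 0` and `diam G = 2 / K`. -/
structure IsBonnetMyersSharp [Fintype V] (G : SimpleGraph V) [DecidableRel G.Adj]
    (D : ℕ) : Prop where
  connected : G.Connected
  regular : G.IsRegularOfDegree D
  curvature_pos : 0 < curvatureInf G D
  diam_eq : (G.diam : ℝ) = 2 / curvatureInf G D

open scoped Classical in
/-- The plan induced by a map `T` defined on `B_1(x)`: mass `1/(D+1)` goes from each
`v ∈ B_1(x)` to `T v`, and nothing else is moved. -/
def planOfMap (G : SimpleGraph V) (D : ℕ) (x : V) (T : V → V) (v z : V) : ℝ :=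
  if v ∈ ball G 1 x ∧ z = T v then 1 / ((D : ℝ) + 1) else 0

/-- `T` is a good optimal transport map `B_1(x) → B_1(y)`: a bijection `B_1(x) → B_1(y)` whose
induced plan is an optimal transport plan from `μ_x` to `μ_y`, and whose fixed points are exactly
the points of `B_1(x) ∩ B_1(y)`. Only the values of `T` on `B_1(x)` matter. -/
structure IsGoodOptimalTransportMap [Fintype V] (G : SimpleGraph V) (D : ℕ) (x y : V)
    (T : V → V) : Prop where
  bijOn : Set.BijOn T (ball G 1 x) (ball G 1 y)
  optimal : IsOptimalTransportPlan G (mu G D x) (mu G D y) (planOfMap G D x T)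
  fixed_iff : ∀ v ∈ ball G 1 x, T v = v ↔ v ∈ ball G 1 x ∩ ball G 1 y

end BonnetMyers

end

/-! ### Counting in the first two spheres around a pole. -/

namespace BonnetMyers

/-! Let `b = D + 1 - D * K`, with `K` the infimum of the curvature. The curvature bound and
Kantorovich duality say that, across any edge, the sum of a 1-Lipschitz function over unit balls
grows by at most `b`. For a pole `x₀` the distance from `x₀` grows by exactly `b` across each
outward edge (`sum_dist_eq`). Hence optimal maps along such edges move mass on geodesics from `x₀`
(`dist_map_eq`), which puts `v` and `w` in the second and third spheres, adjacent to `x₁` and `x₂`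
respectively.

What remains is to show that `u` and `x₂` are at distance at least 3. Adding the indicator of a set
`A` closed under steps towards `x₀` to the distance function leaves it Lipschitz, and the distance
already uses up `b`, so unit balls cannot meet `A` in more points when moving outwards
(`card_inter_le`). Suitable sets `A` show that the common neighbours of `x₀` and a vertex `y` of the
second sphere form a cocktail party graph: each is nonadjacent to exactly one other, its antipode
below `y`. Here `u` is the antipode of `x₁` below `v`. Further counts, some along edges inside the
first sphere, control adjacency in the second sphere and exclude every path of length at most 2 from
`u` to `x₂` (`three_le_dist`).

Finally, an interval has diameter at most the distance of its ends, here 3, so `u` and `x₂` are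
antipoles in it. -/

open scoped Classical in
/-- The closed ball of radius one, as a finset. -/
noncomputable def unitBall {V : Type*} [Fintype V] (G : SimpleGraph V) (y : V) : Finset V :=
  Finset.univ.filter fun z => z = y ∨ G.Adj y z

/-- The consequences of Bonnet-Myers sharpness that are seen from a pole `x₀`: transport along
any edge costs at most `b` (in units of `1 / (D + 1)`, tested against Lipschitz functions), and
the distance function from `x₀` attains this bound along every edge pointing away from `x₀`. -/
structure IsSharpFrom {V : Type*} [Fintype V] (G : SimpleGraph V) (x₀ : V) (D b : ℤ) : Prop where
  connected : G.Connected
  card_unitBall : ∀ y, ((unitBall G y).card : ℤ) = D + 1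
  sum_le : ∀ x y, G.Adj x y → ∀ h : V → ℤ, (∀ p q, G.Adj p q → h q ≤ h p + 1) →
    ∑ z ∈ unitBall G y, h z ≤ ∑ z ∈ unitBall G x, h z + b
  sum_dist : ∀ y, ∑ z ∈ unitBall G y, (G.dist x₀ z : ℤ) = D + b * G.dist x₀ y

section Local

variable {V : Type*} [Fintype V] {G : SimpleGraph V} {x₀ : V} {D b : ℤ}

theorem mem_unitBall {y z : V} : z ∈ unitBall G y ↔ z = y ∨ G.Adj y z := by
  simp [unitBall]

theorem dist_le_of_adj (hc : G.Connected) (x : V) {p q : V} (h : G.Adj p q) :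
    G.dist x q ≤ G.dist x p + 1 := by
  have := hc.dist_triangle (u := x) (v := p) (w := q)
  rwa [SimpleGraph.dist_eq_one_iff_adj.2 h] at this

theorem dist_le_of_adj' (hc : G.Connected) (x : V) {p q : V} (h : G.Adj p q) :
    G.dist x p ≤ G.dist x q + 1 := dist_le_of_adj hc x h.symm

namespace IsSharpFrom

/-- Sets that are closed under steps towards `x₀` meet unit balls in fewer points as one moves
away from `x₀`. -/
theorem card_inter_le (S : IsSharpFrom G x₀ D b) [DecidableEq V] {x y : V} (hxy : G.Adj x y)
    (hd : G.dist x₀ y = G.dist x₀ x + 1) (A : Finset V)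
    (hA : ∀ p q, G.Adj p q → q ∈ A → G.dist x₀ q = G.dist x₀ p + 1 → p ∈ A) :
    (unitBall G y ∩ A).card ≤ (unitBall G x ∩ A).card := by
  have h := S.sum_le x y hxy (fun z => (G.dist x₀ z : ℤ) + if z ∈ A then 1 else 0) ?_
  -- The distance part accounts for all of `b`, so nothing is left for the indicator of `A`.
  · rw [Finset.sum_add_distrib, Finset.sum_add_distrib, S.sum_dist, S.sum_dist, hd,
      Finset.sum_ite_mem, Finset.sum_ite_mem] at h
    simp only [Finset.sum_const, nsmul_eq_mul, mul_one] at h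
    push_cast at h
    have : ((unitBall G y ∩ A).card : ℤ) ≤ (unitBall G x ∩ A).card := by linarith
    exact_mod_cast this
  · intro p q hpq
    have h1 := dist_le_of_adj S.connected x₀ hpq
    have h2 := hA p q hpq
    show (G.dist x₀ q : ℤ) + _ ≤ (G.dist x₀ p : ℤ) + _ + 1
    by_cases hq : q ∈ A <;> by_cases hp : p ∈ A <;> simp only [hq, hp, if_true, if_false]
    · omega
    · have : G.dist x₀ q ≠ G.dist x₀ p + 1 := fun h => hp (h2 hq h)
      omega
    · omega
    · omega

theorem eq_of_dist_eq_zero (S : IsSharpFrom G x₀ D b) {p : V} (h : G.dist x₀ p = 0) : p = x₀ :=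
  ((S.connected.dist_eq_zero_iff).1 h).symm

theorem adj_of_dist_eq_one {p : V} (h : G.dist x₀ p = 1) : G.Adj x₀ p :=
  SimpleGraph.dist_eq_one_iff_adj.1 h

/-- Two points of the first sphere below `y` that are not adjacent to a given third one agree. -/
theorem antipode_unique (S : IsSharpFrom G x₀ D b) {x y z z' : V} (hx : G.dist x₀ x = 1)
    (hy : G.dist x₀ y = 2) (hxy : G.Adj x y) (hz : G.dist x₀ z = 1) (hz' : G.dist x₀ z' = 1)
    (hzy : G.Adj z y) (hzy' : G.Adj z' y) (hxz : ¬ G.Adj x z) (hxz' : ¬ G.Adj x z')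
    (hne : x ≠ z) (hne' : x ≠ z') : z = z' := by
  classical
  by_contra hzz
  -- The ball of `y` contains `z` and `z'`, while that of `x` contains only `x₀` from this set.
  have h := S.card_inter_le hxy (by omega) {x₀, z, z'} ?_
  · have h1 : ({z, z'} : Finset V) ⊆ unitBall G y ∩ {x₀, z, z'} := by
      intro a ha
      simp only [Finset.mem_insert, Finset.mem_singleton, Finset.mem_inter, mem_unitBall] at ha ⊢
      rcases ha with rfl | rfl
      · exact ⟨Or.inr hzy.symm, by simp⟩
      · exact ⟨Or.inr hzy'.symm, by simp⟩
    have h2 : unitBall G x ∩ {x₀, z, z'} ⊆ {x₀} := by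
      intro a ha
      simp only [Finset.mem_insert, Finset.mem_singleton, Finset.mem_inter, mem_unitBall] at ha ⊢
      obtain ⟨h3, rfl | rfl | rfl⟩ := ha
      · rfl
      · rcases h3 with rfl | h3
        · exact absurd rfl hne
        · exact absurd h3 hxz
      · rcases h3 with rfl | h3
        · exact absurd rfl hne'
        · exact absurd h3 hxz'
    have h3 := Finset.card_le_card h1
    have h4 := Finset.card_le_card h2
    rw [Finset.card_pair hzz] at h3
    simp only [Finset.card_singleton] at h4
    omega
  · intro p q hpq hq hd
    simp only [Finset.mem_insert, Finset.mem_singleton] at hq ⊢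
    left
    apply S.eq_of_dist_eq_zero
    rcases hq with rfl | rfl | rfl
    · rw [SimpleGraph.dist_self] at hd; omega
    · omega
    · omega

open scoped Classical in
/-- The neighbours of `y` in the first sphere. -/
noncomputable def lower (G : SimpleGraph V) (x₀ y : V) : Finset V :=
  Finset.univ.filter fun z => G.dist x₀ z = 1 ∧ G.Adj z y

theorem mem_lower {y z : V} : z ∈ lower G x₀ y ↔ G.dist x₀ z = 1 ∧ G.Adj z y := by
  simp [lower]

/-- Without an antipode, the unit ball of `x` would contain all of `{x₀, y} ∪ lower G x₀ y`, whereas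
that of `x₀` misses `y`. This contradicts `card_inter_le` on the edge from `x₀` to `x`. -/
theorem exists_antipode (S : IsSharpFrom G x₀ D b) {x y : V} (hx : G.dist x₀ x = 1)
    (hy : G.dist x₀ y = 2) (hxy : G.Adj x y) :
    ∃ z, G.dist x₀ z = 1 ∧ G.Adj z y ∧ ¬ G.Adj x z ∧ x ≠ z := by
  classical
  by_contra! hcon
  have h := S.card_inter_le (adj_of_dist_eq_one hx) (by simp [hx])
    (insert x₀ (insert y (lower G x₀ y))) ?_
  · have h1 : insert x₀ (insert y (lower G x₀ y)) ⊆
        unitBall G x ∩ insert x₀ (insert y (lower G x₀ y)) := by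
      intro a ha
      refine Finset.mem_inter.2 ⟨?_, ha⟩
      simp only [Finset.mem_insert, mem_lower, mem_unitBall] at ha ⊢
      rcases ha with rfl | rfl | ⟨h3, h4⟩
      · exact Or.inr (adj_of_dist_eq_one hx).symm
      · exact Or.inr hxy
      · by_cases hxa : G.Adj x a
        · exact Or.inr hxa
        · exact Or.inl (hcon a h3 h4 hxa).symm
    have h2 : unitBall G x₀ ∩ insert x₀ (insert y (lower G x₀ y)) ⊆
        insert x₀ (lower G x₀ y) := by
      intro a ha
      simp only [Finset.mem_insert, Finset.mem_inter, mem_lower, mem_unitBall] at ha ⊢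
      obtain ⟨h3, rfl | rfl | h4⟩ := ha
      · exact Or.inl rfl
      · rcases h3 with rfl | h3
        · exact Or.inl rfl
        · rw [← SimpleGraph.dist_eq_one_iff_adj] at h3; omega
      · exact Or.inr h4
    have h3 := Finset.card_le_card h1
    have h4 := Finset.card_le_card h2
    have hx0 : x₀ ∉ lower G x₀ y := by simp [mem_lower]
    have hyl : y ∉ lower G x₀ y := by simp [mem_lower]
    have hxy0 : x₀ ≠ y := by rintro rfl; simp at hy
    rw [Finset.card_insert_of_notMem (by simp [hx0, hxy0]), Finset.card_insert_of_notMem hyl] at h3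
    rw [Finset.card_insert_of_notMem hx0] at h4
    omega
  · intro p q hpq hq hd
    simp only [Finset.mem_insert, mem_lower] at hq ⊢
    rcases hq with rfl | rfl | ⟨h3, h4⟩
    · rw [SimpleGraph.dist_self] at hd; omega
    · exact Or.inr (Or.inr ⟨by omega, hpq⟩)
    · exact Or.inl (S.eq_of_dist_eq_zero (by omega))

/-- Nonadjacent points of the first sphere have at most one common neighbour in the second. -/
theorem join_unique (S : IsSharpFrom G x₀ D b) {x u y y' : V} (hx : G.dist x₀ x = 1)
    (hu : G.dist x₀ u = 1) (hxu : ¬ G.Adj x u) (hne : x ≠ u) (hy : G.dist x₀ y = 2)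
    (hy' : G.dist x₀ y' = 2) (hxy : G.Adj x y) (hxy' : G.Adj x y') (huy : G.Adj u y)
    (huy' : G.Adj u y') : y = y' := by
  classical
  by_contra hyy
  set A := insert x₀ (insert y (insert y' (lower G x₀ y ∪ lower G x₀ y'))) with hAdef
  -- By uniqueness of antipodes, `u` is the only point of `A` outside the ball of `x`, but the ball
  -- of `x₀` misses both `y` and `y'`.
  have h := S.card_inter_le (adj_of_dist_eq_one hx) (by simp [hx]) A ?_
  · have hx0 : x₀ ∉ lower G x₀ y ∪ lower G x₀ y' := by simp [mem_lower]
    have hyl : y ∉ lower G x₀ y ∪ lower G x₀ y' := by simp [mem_lower, hy]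
    have hyl' : y' ∉ lower G x₀ y ∪ lower G x₀ y' := by simp [mem_lower, hy']
    have hxy0 : x₀ ≠ y := by rintro rfl; simp at hy
    have hxy0' : x₀ ≠ y' := by rintro rfl; simp at hy'
    have h1 : A ⊆ insert u (unitBall G x ∩ A) := by
      intro a ha
      by_cases hau : a = u
      · simp [hau]
      refine Finset.mem_insert_of_mem (Finset.mem_inter.2 ⟨?_, ha⟩)
      simp only [hAdef, Finset.mem_insert, Finset.mem_union, mem_lower, mem_unitBall] at ha ⊢
      rcases ha with rfl | rfl | rfl | ⟨h3, h4⟩ | ⟨h3, h4⟩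
      · exact Or.inr (adj_of_dist_eq_one hx).symm
      · exact Or.inr hxy
      · exact Or.inr hxy'
      · by_contra! hcon
        exact hau (S.antipode_unique hx hy hxy h3 hu h4 huy hcon.2 hxu hcon.1.symm hne)
      · by_contra! hcon
        exact hau (S.antipode_unique hx hy' hxy' h3 hu h4 huy' hcon.2 hxu hcon.1.symm hne)
    have h2 : unitBall G x₀ ∩ A ⊆ insert x₀ (lower G x₀ y ∪ lower G x₀ y') := by
      intro a ha
      simp only [hAdef, Finset.mem_insert, Finset.mem_inter, mem_unitBall] at ha ⊢
      obtain ⟨h3, rfl | rfl | rfl | h4⟩ := ha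
      · exact Or.inl rfl
      · rcases h3 with rfl | h3
        · exact Or.inl rfl
        · rw [← SimpleGraph.dist_eq_one_iff_adj] at h3; omega
      · rcases h3 with rfl | h3
        · exact Or.inl rfl
        · rw [← SimpleGraph.dist_eq_one_iff_adj] at h3; omega
      · exact Or.inr h4
    have h3 := (Finset.card_le_card h1).trans (Finset.card_insert_le _ _)
    have h4 := Finset.card_le_card h2
    have h5 : A.card = (lower G x₀ y ∪ lower G x₀ y').card + 3 := by
      rw [hAdef, Finset.card_insert_of_notMem (by
        rw [Finset.mem_insert, Finset.mem_insert]; tauto),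
        Finset.card_insert_of_notMem (by rw [Finset.mem_insert]; tauto),
        Finset.card_insert_of_notMem hyl']
    rw [Finset.card_insert_of_notMem hx0] at h4
    omega
  · intro p q hpq hq hd
    simp only [hAdef, Finset.mem_insert, Finset.mem_union, mem_lower] at hq ⊢
    rcases hq with rfl | rfl | rfl | h3 | h3
    · rw [SimpleGraph.dist_self] at hd; omega
    · exact Or.inr (Or.inr (Or.inr (Or.inl ⟨by omega, hpq⟩)))
    · exact Or.inr (Or.inr (Or.inr (Or.inr ⟨by omega, hpq⟩)))
    · exact Or.inl (S.eq_of_dist_eq_zero (by omega))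
    · exact Or.inl (S.eq_of_dist_eq_zero (by omega))

open scoped Classical in
/-- Every point of the first sphere has `b` neighbours in the second sphere. -/
theorem card_upper (S : IsSharpFrom G x₀ D b) {x : V} (hx : G.dist x₀ x = 1) :
    (((unitBall G x).filter fun z => G.dist x₀ z = 2).card : ℤ) = b := by
  have h := S.sum_dist x
  have h1 : ∀ z ∈ unitBall G x, (G.dist x₀ z : ℤ) =
      1 - (if z = x₀ then 1 else 0) + (if G.dist x₀ z = 2 then 1 else 0) := by
    intro z hz
    by_cases hz0 : z = x₀
    · simp [hz0]
    have h2 : G.dist x₀ z ≠ 0 := fun h => hz0 (S.eq_of_dist_eq_zero h)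
    have h3 : G.dist x₀ z ≤ 2 := by
      rcases mem_unitBall.1 hz with rfl | h3
      · omega
      · have := dist_le_of_adj S.connected x₀ h3; omega
    by_cases h4 : G.dist x₀ z = 2
    · simp [hz0, h4]
    · have : G.dist x₀ z = 1 := by omega
      simp [hz0, this]
  rw [Finset.sum_congr rfl h1, Finset.sum_add_distrib, Finset.sum_sub_distrib,
    Finset.sum_ite_eq', if_pos (mem_unitBall.2 (Or.inr (adj_of_dist_eq_one hx).symm)),
    Finset.sum_const, nsmul_eq_mul, mul_one, S.card_unitBall, hx, Finset.sum_boole] at h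
  push_cast at h
  linarith

open scoped Classical in
theorem card_level_one (S : IsSharpFrom G x₀ D b) {x : V} (hx : G.dist x₀ x = 1) :
    (((unitBall G x).filter fun z => G.dist x₀ z ≤ 1).card : ℤ) = D + 1 - b := by
  have h1 := Finset.card_filter_add_card_filter_not (s := unitBall G x)
    (fun z => G.dist x₀ z ≤ 1)
  have h2 : ((unitBall G x).filter fun z => ¬ G.dist x₀ z ≤ 1) =
      (unitBall G x).filter fun z => G.dist x₀ z = 2 := by
    apply Finset.filter_congr
    intro z hz
    rcases mem_unitBall.1 hz with rfl | h3
    · omega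
    · have := dist_le_of_adj S.connected x₀ h3; omega
  rw [h2] at h1
  have h3 := S.card_upper hx
  have h4 := S.card_unitBall x
  omega

-- Levels 1, 2 and 3 exhaust the ball, so its size and the sum of its distances to `x₀` determine
-- the level 2 count. The form `2 * m + 1` is what `adj_or_adj` needs: `card_nonadj_le` bounds by
-- `m` each of two sets that cover all of level 2 but `y`.
open scoped Classical in
theorem card_level_two (S : IsSharpFrom G x₀ D b) {y : V} (hy : G.dist x₀ y = 2) :
    (((unitBall G y).filter fun z => G.dist x₀ z = 2).card : ℤ) =
      2 * (D + 1 - b - (lower G x₀ y).card) + 1 := by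
  have h := S.sum_dist y
  have hb : ∀ z ∈ unitBall G y,
      G.dist x₀ z = 1 ∨ G.dist x₀ z = 2 ∨ G.dist x₀ z = 3 := by
    intro z hz
    rcases mem_unitBall.1 hz with rfl | h3
    · omega
    · have := dist_le_of_adj S.connected x₀ h3
      have := dist_le_of_adj' S.connected x₀ h3
      omega
  have h1 : ∀ z ∈ unitBall G y, (G.dist x₀ z : ℤ) =
      3 - (if G.dist x₀ z = 2 then 1 else 0) - 2 * (if G.dist x₀ z = 1 then 1 else 0) := by
    intro z hz
    rcases hb z hz with h2 | h2 | h2 <;> simp [h2]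
  have h2 : ((unitBall G y).filter fun z => G.dist x₀ z = 1) = lower G x₀ y := by
    ext z
    simp only [Finset.mem_filter, mem_unitBall, mem_lower]
    constructor
    · rintro ⟨rfl | h3, h4⟩
      · omega
      · exact ⟨h4, h3.symm⟩
    · rintro ⟨h3, h4⟩
      exact ⟨Or.inr h4.symm, h3⟩
  rw [Finset.sum_congr rfl h1, Finset.sum_sub_distrib, Finset.sum_sub_distrib, ← Finset.mul_sum,
    Finset.sum_const, nsmul_eq_mul, S.card_unitBall, hy, Finset.sum_boole, Finset.sum_boole,
    h2] at h
  push_cast at h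
  linarith

end IsSharpFrom

end Local

end BonnetMyers

/-! ### Edges inside the first sphere, adjacency in the second, and the distance bound. -/

namespace BonnetMyers

namespace IsSharpFrom

variable {V : Type*} [Fintype V] {G : SimpleGraph V} {x₀ : V} {D b : ℤ}

/-- Every function with values 0 and 1 is 1-Lipschitz, so the indicator of the difference is a valid
test function. -/
theorem card_sdiff_le (S : IsSharpFrom G x₀ D b) [DecidableEq V] {x t : V} (hxt : G.Adj x t) :
    ((unitBall G t \ unitBall G x).card : ℤ) ≤ b := by
  have h := S.sum_le x t hxt (fun z => if z ∈ unitBall G t \ unitBall G x then 1 else 0) ?_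
  · rw [Finset.sum_ite_mem, Finset.sum_ite_mem,
      Finset.inter_eq_right.2 Finset.sdiff_subset, Finset.inter_sdiff_self] at h
    simpa using h
  · intro p q _
    split_ifs <;> norm_num

open scoped Classical in
/-- The points of the first sphere adjacent to `t` but neither equal nor adjacent to `x`. -/
noncomputable def private1 (G : SimpleGraph V) (x₀ x t : V) : Finset V :=
  (unitBall G t \ unitBall G x).filter fun z => G.dist x₀ z = 1

open scoped Classical in
/-- The common neighbours of `x` and `t` in the second sphere. -/
noncomputable def common2 (G : SimpleGraph V) (x₀ x t : V) : Finset V :=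
  (unitBall G t ∩ unitBall G x).filter fun z => G.dist x₀ z = 2

-- Outside the ball of `x`, the ball of `t` consists of its private points and of those among its
-- `b` upper neighbours that are not shared with `x`.
open scoped Classical in
theorem card_sdiff_add (S : IsSharpFrom G x₀ D b) {x t : V} (hx : G.dist x₀ x = 1)
    (ht : G.dist x₀ t = 1) :
    ((unitBall G t \ unitBall G x).card : ℤ) + (common2 G x₀ x t).card =
      b + (private1 G x₀ x t).card := by
  have h1 := Finset.card_filter_add_card_filter_not (s := unitBall G t \ unitBall G x)
    (fun z => G.dist x₀ z = 1)
  have h2 : ((unitBall G t \ unitBall G x).filter fun z => ¬ G.dist x₀ z = 1) =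
      ((unitBall G t).filter fun z => G.dist x₀ z = 2) \ common2 G x₀ x t := by
    ext z
    simp only [common2, Finset.mem_filter, Finset.mem_sdiff, Finset.mem_inter]
    constructor
    · rintro ⟨⟨h3, h4⟩, h5⟩
      have h6 : G.dist x₀ z ≠ 0 := by
        intro h
        rw [S.eq_of_dist_eq_zero h, mem_unitBall] at h4
        exact h4 (Or.inr (adj_of_dist_eq_one hx).symm)
      have h7 : G.dist x₀ z ≤ 2 := by
        rcases mem_unitBall.1 h3 with rfl | h3
        · omega
        · have := dist_le_of_adj S.connected x₀ h3; omega
      exact ⟨⟨h3, by omega⟩, fun h => h4 h.1.2⟩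
    · rintro ⟨⟨h3, h4⟩, h5⟩
      exact ⟨⟨h3, fun h => h5 ⟨⟨h3, h⟩, h4⟩⟩, by omega⟩
  have h3 : common2 G x₀ x t ⊆ (unitBall G t).filter fun z => G.dist x₀ z = 2 := by
    intro z hz
    simp only [common2, Finset.mem_filter, Finset.mem_inter] at hz ⊢
    exact ⟨hz.1.1, hz.2⟩
  have h4 := Finset.card_sdiff_add_card_eq_card h3
  have h5 := S.card_upper ht
  rw [h2] at h1
  unfold private1
  omega

theorem mem_private1 {x t z : V} (hxt : G.Adj x t) :
    z ∈ private1 G x₀ x t ↔ G.dist x₀ z = 1 ∧ G.Adj t z ∧ ¬ G.Adj x z ∧ x ≠ z := by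
  simp only [private1, Finset.mem_filter, Finset.mem_sdiff, mem_unitBall, not_or]
  constructor
  · rintro ⟨⟨rfl | h1, h2, h3⟩, h4⟩
    · exact absurd hxt h3
    · exact ⟨h4, h1, h3, fun h => h2 h.symm⟩
  · rintro ⟨h1, h2, h3, h4⟩
    exact ⟨⟨Or.inr h2, fun h => h4 h.symm, h3⟩, h1⟩

theorem mem_common2 {x t z : V} (hx : G.dist x₀ x = 1) (ht : G.dist x₀ t = 1) :
    z ∈ common2 G x₀ x t ↔ G.dist x₀ z = 2 ∧ G.Adj t z ∧ G.Adj x z := by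
  simp only [common2, Finset.mem_filter, Finset.mem_inter, mem_unitBall]
  constructor
  · rintro ⟨⟨rfl | h1, rfl | h2⟩, h3⟩
    · omega
    · omega
    · omega
    · exact ⟨h3, h1, h2⟩
  · rintro ⟨h1, h2, h3⟩
    exact ⟨⟨Or.inr h2, Or.inr h3⟩, h1⟩

/-- A neighbour of `y` in the first sphere is adjacent to all other such neighbours but its
antipode. -/
theorem adj_of_ne_antipode (S : IsSharpFrom G x₀ D b) {x z t y : V} (hx : G.dist x₀ x = 1)
    (hz : G.dist x₀ z = 1) (ht : G.dist x₀ t = 1) (hy : G.dist x₀ y = 2) (hxy : G.Adj x y)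
    (hzy : G.Adj z y) (hty : G.Adj t y) (hxz : ¬ G.Adj x z) (hne : x ≠ z) (htx : t ≠ x)
    (htz : t ≠ z) : G.Adj t z := by
  by_contra h
  exact htx (S.antipode_unique hz hy hzy ht hx hty hxy (fun h' => h h'.symm)
    (fun h' => hxz h'.symm) htz.symm hne.symm)

/-- For an edge `x ~ t` of the first sphere, taking antipodes of `x` maps the common neighbours of
`x` and `t` in the second sphere onto the private neighbours of `t` in the first sphere. -/
theorem common2_surj_and_card (S : IsSharpFrom G x₀ D b) [DecidableEq V] {x t : V}
    (hx : G.dist x₀ x = 1)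
    (ht : G.dist x₀ t = 1) (hxt : G.Adj x t) :
    (∀ u ∈ private1 G x₀ x t, ∃ v ∈ common2 G x₀ x t, G.Adj u v) ∧
      ((unitBall G t \ unitBall G x).card : ℤ) = b := by
  have h : ∀ v ∈ common2 G x₀ x t, ∃ z ∈ private1 G x₀ x t, G.Adj z v := by
    intro v hv
    obtain ⟨hv2, htv, hxv⟩ := (mem_common2 hx ht).1 hv
    obtain ⟨z, hz, hzv, hxz, hne⟩ := S.exists_antipode hx hv2 hxv
    refine ⟨z, (mem_private1 hxt).2 ⟨hz, ?_, hxz, hne⟩, hzv⟩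
    exact S.adj_of_ne_antipode hx hz ht hv2 hxv hzv htv hxz hne hxt.ne'
      (fun h => hxz (h ▸ hxt))
  choose! g hg hgv using h
  have hinj : Set.InjOn g (common2 G x₀ x t) := by
    intro v hv v' hv' hvv
    obtain ⟨hv2, -, hxv⟩ := (mem_common2 hx ht).1 hv
    obtain ⟨hv2', -, hxv'⟩ := (mem_common2 hx ht).1 hv'
    obtain ⟨hz, -, hxz, hne⟩ := (mem_private1 hxt).1 (hg v hv)
    exact S.join_unique hx hz hxz hne hv2 hv2' hxv hxv' (hgv v hv) (hvv ▸ hgv v' hv')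
  have h1 := S.card_sdiff_le hxt
  have h2 := S.card_sdiff_add hx ht
  have h2' : ((unitBall G t \ unitBall G x).card : ℤ) + (common2 G x₀ x t).card =
      b + (private1 G x₀ x t).card := by
    convert h2
  -- The injection gives one inequality between the two cardinalities, `card_sdiff_le` the other;
  -- hence `g` is onto and the difference of the balls has exactly `b` points.
  have h3 := Finset.card_le_card_of_injOn g hg hinj
  refine ⟨?_, by omega⟩
  have h4 := Finset.surjOn_of_injOn_of_card_le g hg hinj (by omega)
  intro u hu
  obtain ⟨v, hv, rfl⟩ := h4 hu
  exact ⟨v, hv, hgv v hv⟩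

/-- The join of two nonadjacent points of the first sphere is adjacent to all their common
neighbours in the first sphere. -/
theorem adj_join (S : IsSharpFrom G x₀ D b) {x t u v : V} (hx : G.dist x₀ x = 1)
    (ht : G.dist x₀ t = 1) (hu : G.dist x₀ u = 1) (hv : G.dist x₀ v = 2) (hxt : G.Adj x t)
    (htu : G.Adj t u) (hxu : ¬ G.Adj x u) (hne : x ≠ u) (hxv : G.Adj x v) (huv : G.Adj u v) :
    G.Adj t v := by
  classical
  obtain ⟨v', hv', huv'⟩ := (S.common2_surj_and_card hx ht hxt).1 u
    ((mem_private1 hxt).2 ⟨hu, htu, hxu, hne⟩)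
  obtain ⟨hv2, htv', hxv'⟩ := (mem_common2 hx ht).1 hv'
  rwa [S.join_unique hx hu hxu hne hv hv2 hxv hxv' huv huv']

/-- Matching of private neighbours along an edge of the first sphere. -/
theorem exists_match (S : IsSharpFrom G x₀ D b) {x t v : V} (hx : G.dist x₀ x = 1)
    (ht : G.dist x₀ t = 1) (hv : G.dist x₀ v = 2) (hxt : G.Adj x t) (hxv : G.Adj x v)
    (htv : ¬ G.Adj t v) :
    ∃ z, G.dist x₀ z = 2 ∧ G.Adj z t ∧ G.Adj z v ∧ ¬ G.Adj x z := by
  classical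
  have hvt : v ∉ unitBall G t := by
    rw [mem_unitBall]
    rintro (rfl | h)
    · omega
    · exact htv h
  have hvx : v ∈ unitBall G x := mem_unitBall.2 (Or.inr hxv)
  have key : ∃ z ∈ unitBall G t \ unitBall G x, G.Adj z v := by
    by_contra! hcon
    -- A jump of 2 could only occur from `v` to a neighbour in the difference set, which `hcon`
    -- forbids. The sum is `b` over the ball of `t` and `-1` over that of `x`: one more than
    -- allowed.
    have h := S.sum_le x t hxt (fun z => (if z ∈ unitBall G t \ unitBall G x then 1 else 0) -
      (if z = v then 1 else 0)) ?_
    · have hc := (S.common2_surj_and_card hx ht hxt).2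
      rw [Finset.sum_sub_distrib, Finset.sum_sub_distrib, Finset.sum_ite_mem, Finset.sum_ite_mem,
        Finset.inter_eq_right.2 Finset.sdiff_subset, Finset.inter_sdiff_self,
        Finset.sum_ite_eq', Finset.sum_ite_eq', if_neg hvt, if_pos hvx, Finset.sum_const,
        nsmul_eq_mul, mul_one, hc] at h
      simp at h
    · intro p q hpq
      by_cases hq : q ∈ unitBall G t \ unitBall G x
      · have hpv : p ≠ v := fun h => hcon q hq (h ▸ hpq.symm)
        rw [if_neg hpv]
        split_ifs <;> norm_num
      · rw [if_neg hq]
        split_ifs <;> norm_num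
  obtain ⟨z, hz, hzv⟩ := key
  rw [Finset.mem_sdiff, mem_unitBall, mem_unitBall, not_or] at hz
  obtain ⟨hzt, hzx, hxz⟩ := hz
  have hzt : G.Adj t z := by
    rcases hzt with rfl | h
    · exact absurd hxt hxz
    · exact h
  refine ⟨z, ?_, hzt.symm, hzv, hxz⟩
  have h1 := dist_le_of_adj S.connected x₀ hzt
  have h2 := dist_le_of_adj S.connected x₀ hzv
  have h3 : G.dist x₀ z ≠ 1 := fun h =>
    htv (S.adj_join hx ht h hv hxt hzt hxz (fun h => hzx h.symm) hxv hzv)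
  omega

-- Apply `card_inter_le` to the closed unit ball of `x₀` together with these nonneighbours, none of
-- which the ball of `x` meets.
open scoped Classical in
theorem card_nonadj_le (S : IsSharpFrom G x₀ D b) {x y : V} (hx : G.dist x₀ x = 1)
    (hy : G.dist x₀ y = 2) (hxy : G.Adj x y) :
    (((unitBall G y).filter fun z => G.dist x₀ z = 2 ∧ ¬ G.Adj x z).card : ℤ) ≤
      D + 1 - b - (lower G x₀ y).card := by
  set R := (unitBall G y).filter fun z => G.dist x₀ z = 2 ∧ ¬ G.Adj x z with hR
  have h := S.card_inter_le hxy (by omega) (Finset.univ.filter (fun z => G.dist x₀ z ≤ 1) ∪ R) ?_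
  · have h1 : lower G x₀ y ∪ R ⊆
        unitBall G y ∩ (Finset.univ.filter (fun z => G.dist x₀ z ≤ 1) ∪ R) := by
      intro z hz
      simp only [hR, Finset.mem_union, Finset.mem_inter, Finset.mem_filter, mem_lower,
        mem_unitBall, Finset.mem_univ, true_and] at hz ⊢
      rcases hz with ⟨h1, h2⟩ | hz
      · exact ⟨Or.inr h2.symm, Or.inl h1.le⟩
      · exact ⟨hz.1, Or.inr hz⟩
    have h2 : unitBall G x ∩ (Finset.univ.filter (fun z => G.dist x₀ z ≤ 1) ∪ R) ⊆
        (unitBall G x).filter fun z => G.dist x₀ z ≤ 1 := by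
      intro z hz
      simp only [hR, Finset.mem_union, Finset.mem_inter, Finset.mem_filter,
        mem_unitBall, Finset.mem_univ, true_and] at hz ⊢
      obtain ⟨h1, h2 | ⟨-, h3, h4⟩⟩ := hz
      · exact ⟨h1, h2⟩
      · rcases h1 with rfl | h1
        · omega
        · exact absurd h1 h4
    have h3 := Finset.card_le_card h1
    have h4 := Finset.card_le_card h2
    rw [Finset.card_union_of_disjoint] at h3
    · have h5 := S.card_level_one hx
      omega
    · rw [Finset.disjoint_left]
      intro z hz hz'
      rw [mem_lower] at hz
      rw [hR, Finset.mem_filter] at hz'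
      omega
  · intro p q _ hq hd
    simp only [hR, Finset.mem_union, Finset.mem_filter, Finset.mem_univ, true_and] at hq ⊢
    left
    rcases hq with hq | ⟨_, hq, _⟩ <;> omega

/-- A neighbour of `y` in the second sphere is adjacent to a point out of every antipodal pair
below `y`. -/
theorem adj_or_adj (S : IsSharpFrom G x₀ D b) {x u y z : V} (hx : G.dist x₀ x = 1)
    (hu : G.dist x₀ u = 1) (hy : G.dist x₀ y = 2) (hz : G.dist x₀ z = 2) (hxu : ¬ G.Adj x u)
    (hne : x ≠ u) (hxy : G.Adj x y) (huy : G.Adj u y) (hyz : G.Adj y z) :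
    G.Adj x z ∨ G.Adj u z := by
  classical
  by_contra! hcon
  have h1 := S.card_nonadj_le hx hy hxy
  have h2 := S.card_nonadj_le hu hy huy
  have h3 := S.card_level_two hy
  set R := (unitBall G y).filter fun z => G.dist x₀ z = 2 ∧ ¬ G.Adj x z with hR
  set R' := (unitBall G y).filter fun z => G.dist x₀ z = 2 ∧ ¬ G.Adj u z with hR'
  -- Only `y` is adjacent to both `x` and `u`, so `R` and `R'` cover the rest of level 2. The counts
  -- then force them to be disjoint, but `z` lies in both.
  have h4 : ((unitBall G y).filter fun z => G.dist x₀ z = 2) ⊆ insert y (R ∪ R') := by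
    intro a ha
    rw [Finset.mem_filter] at ha
    by_cases hay : a = y
    · simp [hay]
    refine Finset.mem_insert_of_mem (Finset.mem_union.2 ?_)
    by_contra! hn
    simp only [hR, hR', Finset.mem_filter, not_and, not_not] at hn
    exact hay (S.join_unique hx hu hxu hne ha.2 hy (hn.1 ha.1 ha.2) hxy (hn.2 ha.1 ha.2) huy)
  have h5 : ({z} : Finset V) ⊆ R ∩ R' := by
    have hzb : z ∈ unitBall G y := mem_unitBall.2 (Or.inr hyz)
    rw [Finset.singleton_subset_iff, Finset.mem_inter, hR, hR', Finset.mem_filter,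
      Finset.mem_filter]
    exact ⟨⟨hzb, hz, hcon.1⟩, ⟨hzb, hz, hcon.2⟩⟩
  have h6 := (Finset.card_le_card h4).trans (Finset.card_insert_le _ _)
  have h7 := Finset.card_le_card h5
  have h8 := Finset.card_union_add_card_inter R R'
  rw [Finset.card_singleton] at h7
  omega

/-- If two points of the first sphere, both nonadjacent to `x`, are adjacent to each other, then so
are their joins with `x`. -/
theorem adj_of_antipodes_adj (S : IsSharpFrom G x₀ D b) {x u u' v y : V} (hx : G.dist x₀ x = 1)
    (hu : G.dist x₀ u = 1) (hu' : G.dist x₀ u' = 1) (hv : G.dist x₀ v = 2) (hy : G.dist x₀ y = 2)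
    (hxu : ¬ G.Adj x u) (hne : x ≠ u) (hxu' : ¬ G.Adj x u') (hne' : x ≠ u') (huu : G.Adj u u')
    (hxv : G.Adj x v) (huv : G.Adj u v) (hxy : G.Adj x y) (huy : G.Adj u' y) : G.Adj v y := by
  have h1 : ¬ G.Adj u' v := fun h =>
    huu.ne (S.antipode_unique hx hv hxv hu hu' huv h hxu hxu' hne hne')
  -- The matched point `z` turns out to be the join of `x` and `u'`, that is, `y`.
  obtain ⟨z, hz, hzu, hzv, hz'⟩ := S.exists_match hu hu' hv huu huv h1
  have h2 : G.Adj x z := (S.adj_or_adj hx hu hv hz hxu hne hxv huv hzv.symm).resolve_right hz'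
  rw [S.join_unique hx hu' hxu' hne' hy hz hxy h2 huy hzu.symm]
  exact hzv.symm

/-- Distinct points of the second sphere that have two adjacent lower neighbours in common are
adjacent. -/
theorem adj_of_common_lower (S : IsSharpFrom G x₀ D b) {x t v y : V} (hx : G.dist x₀ x = 1)
    (ht : G.dist x₀ t = 1) (hv : G.dist x₀ v = 2) (hy : G.dist x₀ y = 2)
    (hxt : G.Adj x t) (hxv : G.Adj x v) (htv : G.Adj t v) (hxy : G.Adj x y) (hty : G.Adj t y)
    (hvy : v ≠ y) : G.Adj v y := by
  obtain ⟨t', ht', hty', htt', hnt'⟩ := S.exists_antipode ht hy hty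
  obtain ⟨s, hs, hsv, hts, hns⟩ := S.exists_antipode ht hv htv
  have hxt' : G.Adj x t' := S.adj_of_ne_antipode ht ht' hx hy hty hty' hxy htt' hnt' hxt.ne
    (fun h => htt' (h ▸ hxt.symm))
  have hxs : G.Adj x s := S.adj_of_ne_antipode ht hs hx hv htv hsv hxv hts hns hxt.ne
    (fun h => hts (h ▸ hxt.symm))
  have htv' : ¬ G.Adj t' v := fun h => hvy (S.join_unique ht ht' htt' hnt' hv hy htv hty h hty')
  obtain ⟨z, hz, hzt, hzv, hxz⟩ := S.exists_match hx ht' hv hxt' hxv htv'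
  have hsz : G.Adj s z := by
    refine (S.adj_or_adj ht hs hv hz hts hns htv hsv hzv.symm).resolve_left fun h => hxz ?_
    rwa [S.join_unique ht ht' htt' hnt' hz hy h hty hzt.symm hty']
  -- Otherwise `z` would be the join of `s` and `t'`, and their common neighbour `x` would be
  -- adjacent to it.
  have hst : G.Adj s t' := by
    by_contra h
    have hne : s ≠ t' := fun h' => htv' (h' ▸ hsv)
    exact hxz (S.adj_join hs hx ht' hz hxs.symm hxt' h hne hsz hzt.symm)
  exact S.adj_of_antipodes_adj ht hs ht' hv hy hts hns htt' hnt' hst htv hsv hty hty'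

/-- Let `y ~ z` in the second sphere, let `u` lie below both, and let `x`, not adjacent to `u`, lie
below `y` but not below `z`. Then `x` has a neighbour that lies below `z` but not below `y`. -/
theorem exists_lower_adj (S : IsSharpFrom G x₀ D b) {x u y z : V} (hx : G.dist x₀ x = 1)
    (hu : G.dist x₀ u = 1) (hy : G.dist x₀ y = 2) (hz : G.dist x₀ z = 2) (hxu : ¬ G.Adj x u)
    (hne : x ≠ u) (hxy : G.Adj x y) (huy : G.Adj u y) (hyz : G.Adj y z) (huz : G.Adj u z)
    (hxz : ¬ G.Adj x z) :
    ∃ t, G.dist x₀ t = 1 ∧ G.Adj x t ∧ G.Adj t z ∧ ¬ G.Adj t y := by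
  classical
  by_contra! hcon
  -- With `T` the neighbours of `x` below `z`, the ball of `y` contains `z`, `u` and, by `hcon`, all
  -- of `T`; the ball of `x` retains at most `x₀` and `T`.
  have h := S.card_inter_le hxy (by omega) (insert x₀ (insert z (lower G x₀ z))) ?_
  · set T := (lower G x₀ z).filter fun t => G.Adj x t with hT
    have huT : u ∉ T := fun h => hxu (Finset.mem_filter.1 h).2
    have hzT : z ∉ insert u T := by
      simp only [hT, Finset.mem_insert, Finset.mem_filter, mem_lower, not_or]
      exact ⟨fun h => by rw [h] at hz; omega, fun h => by omega⟩
    have h1 : insert z (insert u T) ⊆ unitBall G y ∩ insert x₀ (insert z (lower G x₀ z)) := by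
      intro a ha
      simp only [hT, Finset.mem_insert, Finset.mem_inter, Finset.mem_filter, mem_lower,
        mem_unitBall] at ha ⊢
      rcases ha with rfl | rfl | ⟨⟨h1, h2⟩, h3⟩
      · exact ⟨Or.inr hyz, by simp⟩
      · exact ⟨Or.inr huy.symm, Or.inr (Or.inr ⟨hu, huz⟩)⟩
      · exact ⟨Or.inr (hcon a h1 h3 h2).symm, Or.inr (Or.inr ⟨h1, h2⟩)⟩
    have h2 : unitBall G x ∩ insert x₀ (insert z (lower G x₀ z)) ⊆ insert x₀ T := by
      intro a ha
      simp only [hT, Finset.mem_insert, Finset.mem_inter, Finset.mem_filter, mem_lower,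
        mem_unitBall] at ha ⊢
      obtain ⟨h5, rfl | rfl | h6⟩ := ha
      · exact Or.inl rfl
      · rcases h5 with rfl | h5
        · omega
        · exact absurd h5 hxz
      · rcases h5 with rfl | h5
        · exact absurd h6.2 hxz
        · exact Or.inr ⟨h6, h5⟩
    have h3 := Finset.card_le_card h1
    have h4 := (Finset.card_le_card h2).trans (Finset.card_insert_le _ _)
    rw [Finset.card_insert_of_notMem hzT, Finset.card_insert_of_notMem huT] at h3
    omega
  · intro p q hpq hq hd
    simp only [Finset.mem_insert, mem_lower] at hq ⊢
    rcases hq with rfl | rfl | ⟨h3, h4⟩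
    · rw [SimpleGraph.dist_self] at hd; omega
    · exact Or.inr (Or.inr ⟨by omega, hpq⟩)
    · exact Or.inl (S.eq_of_dist_eq_zero (by omega))

/-- If `v` and `y` are distinct nonadjacent points of the second sphere above `x`, then the antipode
`u` of `x` below `v` has distance at least three from `y`. -/
theorem three_le_dist (S : IsSharpFrom G x₀ D b) {x u v y : V} (hx : G.dist x₀ x = 1)
    (hu : G.dist x₀ u = 1) (hv : G.dist x₀ v = 2) (hy : G.dist x₀ y = 2) (hxu : ¬ G.Adj x u)
    (hne : x ≠ u) (hxv : G.Adj x v) (huv : G.Adj u v) (hxy : G.Adj x y) (hvy : ¬ G.Adj v y)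
    (hne' : v ≠ y) : 3 ≤ G.dist u y := by
  have huy : ¬ G.Adj u y := fun h => hne' (S.join_unique hx hu hxu hne hv hy hxv hxy huv h)
  have huy' : u ≠ y := by rintro rfl; omega
  have key : ∀ z, G.Adj u z → ¬ G.Adj z y := by
    intro z huz hzy
    have h1 := dist_le_of_adj S.connected x₀ huz
    have h2 := dist_le_of_adj S.connected x₀ hzy
    obtain hz | hz : G.dist x₀ z = 1 ∨ G.dist x₀ z = 2 := by omega
    · have hxz : x ≠ z := fun h => hxu (h ▸ huz.symm)
      by_cases hxz' : G.Adj x z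
      · have hzv := S.adj_join hx hz hu hv hxz' huz.symm hxu hne hxv huv
        exact hvy (S.adj_of_common_lower hx hz hv hy hxz' hxv hzv hxy hzy hne')
      · exact hvy (S.adj_of_antipodes_adj hx hu hz hv hy hxu hne hxz' hxz huz hxv huv hxy hzy)
    · obtain ⟨s, hs, hsy, hxs, hns⟩ := S.exists_antipode hx hy hxy
      have hxz : ¬ G.Adj x z := by
        intro h
        rw [S.join_unique hx hu hxu hne hz hv h hxv huz huv] at hzy
        exact hvy hzy
      have hsz : G.Adj s z :=
        (S.adj_or_adj hx hs hy hz hxs hns hxy hsy hzy.symm).resolve_left hxz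
      have hus : ¬ G.Adj u s := fun h =>
        hvy (S.adj_of_antipodes_adj hx hu hs hv hy hxu hne hxs hns h hxv huv hxy hsy)
      have hus' : u ≠ s := fun h => huy (h ▸ hsy)
      obtain ⟨t, ht, hxt, htz, hty⟩ :=
        S.exists_lower_adj hx hs hy hz hxs hns hxy hsy hzy.symm hsz hxz
      -- Below `z` the points `u` and `s` are antipodes, so `t` is adjacent to `s`. As a common
      -- neighbour of `x` and `s`, it is then adjacent to their join `y`, a contradiction.
      have hts : G.Adj t s := S.adj_of_ne_antipode hu hs ht hz huz hsz htz hus hus'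
        (fun h => hxu (h ▸ hxt)) (fun h => hxs (h ▸ hxt))
      exact hty (S.adj_join hx ht hs hy hxt hts hxs hns hxy hsy)
  by_contra! hlt
  obtain ⟨p, hp⟩ := S.connected.exists_walk_length_eq_dist u y
  rw [← hp] at hlt
  match p, hlt with
  | .nil, _ => exact huy' rfl
  | .cons h .nil, _ => exact huy h
  | .cons h (.cons h' .nil), _ => exact key _ h h'
  | .cons _ (.cons _ (.cons _ _)), hlt => simp [SimpleGraph.Walk.length] at hlt; omega

end IsSharpFrom

end BonnetMyers

/-! ### Kantorovich duality and the sharpness identities at a pole. -/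

namespace BonnetMyers

section Transport

variable {V : Type*} [Fintype V] {G : SimpleGraph V} {D : ℕ}

theorem mem_ball_one_iff (hc : G.Connected) {x v : V} : v ∈ ball G 1 x ↔ v ∈ unitBall G x := by
  rw [mem_unitBall, ← SimpleGraph.dist_eq_one_iff_adj, eq_comm (a := v), ← hc.dist_eq_zero_iff]
  show G.dist x v ≤ 1 ↔ _
  omega

open scoped Classical in
theorem mu_eq (hc : G.Connected) (x v : V) :
    mu G D x v = if v ∈ unitBall G x then 1 / ((D : ℝ) + 1) else 0 := by
  simp only [mu, Set.indicator_apply, mem_ball_one_iff hc]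

theorem sum_mul_mu (hc : G.Connected) (x : V) (h : V → ℝ) :
    ∑ v, h v * mu G D x v = (∑ v ∈ unitBall G x, h v) / ((D : ℝ) + 1) := by
  classical
  simp only [mu_eq hc, mul_ite, mul_zero, Finset.sum_ite_mem, Finset.univ_inter]
  rw [← Finset.sum_mul, mul_one_div]

theorem card_unitBall_of_regular [DecidableRel G.Adj] (hr : G.IsRegularOfDegree D) (y : V) :
    (unitBall G y).card = D + 1 := by
  classical
  have : unitBall G y = insert y (G.neighborFinset y) := by
    ext z
    simp [mem_unitBall]
  rw [this, Finset.card_insert_of_notMem (by simp), SimpleGraph.card_neighborFinset_eq_degree,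
    hr y]

/-- A function that is Lipschitz along edges is Lipschitz for the graph distance. -/
theorem le_add_dist (hc : G.Connected) {h : V → ℝ} (hh : ∀ p q, G.Adj p q → h q ≤ h p + 1)
    (p q : V) : h q ≤ h p + G.dist p q := by
  obtain ⟨w, hw⟩ := hc.exists_walk_length_eq_dist p q
  rw [← hw]
  clear hw
  induction w with
  | nil => simp
  | cons hadj w ih =>
    have := hh _ _ hadj
    rw [SimpleGraph.Walk.length_cons]
    push_cast
    linarith

/-- The easy half of Kantorovich duality, for a single plan. -/
theorem sum_sub_sum_le_cost {μ₁ μ₂ : V → ℝ} {π : V → V → ℝ} (hπ : IsTransportPlan μ₁ μ₂ π)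
    {h : V → ℝ} (hh : ∀ p q, h q ≤ h p + G.dist p q) :
    ∑ v, h v * μ₂ v - ∑ v, h v * μ₁ v ≤ cost G π := by
  have h1 : ∑ v, h v * μ₁ v = ∑ x, ∑ y, h x * π x y := by
    simp_rw [hπ.left_marginal, Finset.mul_sum]
  have h2 : ∑ v, h v * μ₂ v = ∑ x, ∑ y, h y * π x y := by
    rw [Finset.sum_comm]
    simp_rw [hπ.right_marginal, Finset.mul_sum]
  rw [h1, h2, ← Finset.sum_sub_distrib]
  refine Finset.sum_le_sum fun x _ => ?_
  rw [← Finset.sum_sub_distrib]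
  refine Finset.sum_le_sum fun y _ => ?_
  rw [← sub_mul]
  exact mul_le_mul_of_nonneg_right (by linarith [hh x y]) (hπ.mem_Icc x y).1

/-- The product coupling. It makes the set defining `W1` nonempty, so that lower bounds on costs
pass to its infimum. -/
theorem exists_isTransportPlan [DecidableRel G.Adj] (hc : G.Connected)
    (hr : G.IsRegularOfDegree D) (x y : V) : ∃ π, IsTransportPlan (mu G D x) (mu G D y) π := by
  have hpos : (0 : ℝ) < D + 1 := by positivity
  have hsum : ∀ z, ∑ v, mu G D z v = 1 := by
    intro z
    have := sum_mul_mu (D := D) hc z (fun _ => 1)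
    simp only [one_mul, Finset.sum_const, card_unitBall_of_regular hr, nsmul_eq_mul, mul_one] at this
    rw [this]
    push_cast
    exact div_self hpos.ne'
  have hmem : ∀ z v, mu G D z v ∈ Set.Icc (0 : ℝ) 1 := by
    classical
    intro z v
    rw [mu_eq hc]
    split_ifs
    · refine ⟨by positivity, ?_⟩
      rw [div_le_one hpos]
      linarith [Nat.cast_nonneg (α := ℝ) D]
    · simp
  refine ⟨fun u v => mu G D x u * mu G D y v, fun u v => ⟨?_, ?_⟩, fun u => ?_, fun v => ?_⟩
  · exact mul_nonneg (hmem _ _).1 (hmem _ _).1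
  · exact mul_le_one₀ (hmem _ _).2 (hmem _ _).1 (hmem _ _).2
  · rw [← Finset.mul_sum, hsum, mul_one]
  · rw [← Finset.sum_mul, hsum, one_mul]

theorem sum_sub_sum_le_W1 [DecidableRel G.Adj] (hc : G.Connected)
    (hr : G.IsRegularOfDegree D) (x y : V) {h : V → ℝ}
    (hh : ∀ p q, G.Adj p q → h q ≤ h p + 1) :
    ∑ v ∈ unitBall G y, h v - ∑ v ∈ unitBall G x, h v ≤
      ((D : ℝ) + 1) * W1 G (mu G D x) (mu G D y) := by
  have hpos : (0 : ℝ) < D + 1 := by positivity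
  have h1 : (∑ v ∈ unitBall G y, h v) / ((D : ℝ) + 1) -
      (∑ v ∈ unitBall G x, h v) / ((D : ℝ) + 1) ≤ W1 G (mu G D x) (mu G D y) := by
    refine le_csInf ?_ ?_
    · obtain ⟨π, hπ⟩ := exists_isTransportPlan hc hr x y
      exact ⟨_, π, hπ, rfl⟩
    · rintro c ⟨π, hπ, rfl⟩
      rw [← sum_mul_mu hc, ← sum_mul_mu hc]
      exact sum_sub_sum_le_cost hπ (le_add_dist hc hh)
  rw [← sub_div, div_le_iff₀ hpos] at h1
  linarith

namespace IsBonnetMyersSharp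

variable [DecidableRel G.Adj]

theorem W1_le (hG : IsBonnetMyersSharp G D) {x y : V} (hxy : G.Adj x y) :
    ((D : ℝ) + 1) * W1 G (mu G D x) (mu G D y) ≤ D + 1 - D * curvatureInf G D := by
  have hD : (0 : ℝ) < D := by
    have h := hG.regular x
    rw [← h]
    exact_mod_cast (G.degree_pos_iff_exists_adj x).2 ⟨y, hxy⟩
  have hpos : (0 : ℝ) < D + 1 := by positivity
  have hle : curvatureInf G D ≤ kappa G D x y := by
    refine csInf_le ?_ ⟨x, y, hxy, rfl⟩
    refine ((Set.finite_range fun p : V × V => kappa G D p.1 p.2).subset ?_).bddBelow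
    rintro c ⟨p, q, -, rfl⟩
    exact ⟨(p, q), rfl⟩
  unfold kappa at hle
  rw [div_mul_eq_mul_div, le_div_iff₀ hD] at hle
  linarith

theorem sum_le (hG : IsBonnetMyersSharp G D) {x y : V} (hxy : G.Adj x y) {h : V → ℝ}
    (hh : ∀ p q, G.Adj p q → h q ≤ h p + 1) :
    ∑ v ∈ unitBall G y, h v ≤
      ∑ v ∈ unitBall G x, h v + (D + 1 - D * curvatureInf G D) := by
  linarith [sum_sub_sum_le_W1 hG.connected hG.regular x y hh, hG.W1_le hxy]

/-- Sum the bound of `sum_le` along a geodesic from `c` to `y`; the ball of `c` itself contributes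
`D`. -/
theorem sum_dist_le (hG : IsBonnetMyersSharp G D) (c y : V) :
    ∑ v ∈ unitBall G y, (G.dist c v : ℝ) ≤
      D + (D + 1 - D * curvatureInf G D) * G.dist c y := by
  obtain ⟨w, hw⟩ := hG.connected.exists_walk_length_eq_dist y c
  have key : ∀ (y c : V) (w : G.Walk y c), ∑ v ∈ unitBall G y, (G.dist c v : ℝ) ≤
      D + (D + 1 - D * curvatureInf G D) * w.length := by
    intro y c w
    induction w with
    | @nil c =>
      classical
      have h1 : ∑ v ∈ unitBall G c, (G.dist c v : ℝ) ≤
          ∑ v ∈ unitBall G c, (1 - if v = c then (1 : ℝ) else 0) := by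
        refine Finset.sum_le_sum fun v hv => ?_
        rcases mem_unitBall.1 hv with rfl | h
        · simp
        · rw [SimpleGraph.dist_eq_one_iff_adj.2 h]
          simp [h.ne']
      rw [Finset.sum_sub_distrib, Finset.sum_ite_eq', if_pos (mem_unitBall.2 (Or.inl rfl)),
        Finset.sum_const, card_unitBall_of_regular hG.regular] at h1
      simpa using h1
    | @cons y z c h w ih =>
      have h1 := hG.sum_le h.symm (h := fun v => (G.dist c v : ℝ)) fun p q hpq => by
        exact_mod_cast dist_le_of_adj hG.connected c hpq
      rw [SimpleGraph.Walk.length_cons]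
      push_cast
      linarith
  have := key y c w
  rwa [hw, SimpleGraph.dist_comm (u := y)] at this

theorem diam_mul (hG : IsBonnetMyersSharp G D) : (G.diam : ℝ) * curvatureInf G D = 2 := by
  rw [hG.diam_eq, div_mul_cancel₀ _ hG.curvature_pos.ne']

/-- On an interval between antipoles the estimate of `sum_dist_le` is sharp, and unit balls do not
leave the interval. -/
theorem sum_dist_eq_of_mem_interval (hG : IsBonnetMyersSharp G D) {x₀ xL y : V}
    (hL : G.dist x₀ xL = G.diam) (hy : G.dist x₀ y + G.dist xL y = G.diam) :
    (∑ v ∈ unitBall G y, (G.dist x₀ v : ℝ) =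
      D + (D + 1 - D * curvatureInf G D) * G.dist x₀ y) ∧
    ∀ z ∈ unitBall G y, G.dist x₀ z + G.dist xL z = G.diam := by
  have h1 := hG.sum_dist_le x₀ y
  have h2 := hG.sum_dist_le xL y
  have h3 : ∀ z ∈ unitBall G y, (G.diam : ℝ) ≤ G.dist x₀ z + G.dist xL z := by
    intro z _
    rw [← hL]
    have := hG.connected.dist_triangle (u := x₀) (v := z) (w := xL)
    rw [SimpleGraph.dist_comm (u := z)] at this
    exact_mod_cast this
  have h4 := Finset.sum_le_sum h3
  have h5 : ∑ z ∈ unitBall G y, (G.diam : ℝ) = (D + 1) * G.diam := by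
    rw [Finset.sum_const, card_unitBall_of_regular hG.regular]
    simp
  have h6 : ((G.dist x₀ y : ℝ) + G.dist xL y) = G.diam := by exact_mod_cast hy
  have h7 := hG.diam_mul
  -- As `diam * K = 2`, the upper bounds for `x₀` and `xL` add up to the lower bound `(D + 1) *
  -- diam` from the triangle inequality, so all of these are equalities.
  have h8 : (D + 1 - D * curvatureInf G D) * G.dist x₀ y +
      (D + 1 - D * curvatureInf G D) * G.dist xL y = (D + 1) * G.diam - 2 * D := by
    rw [← mul_add, h6]
    linear_combination -(D : ℝ) * h7
  have h9 : ∑ z ∈ unitBall G y, ((G.dist x₀ z : ℝ) + G.dist xL z) =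
      ∑ z ∈ unitBall G y, (G.dist x₀ z : ℝ) + ∑ z ∈ unitBall G y, (G.dist xL z : ℝ) :=
    Finset.sum_add_distrib
  refine ⟨by linarith, fun z hz => ?_⟩
  have h10 := (Finset.sum_eq_sum_iff_of_le h3).1 (by linarith) z hz
  exact_mod_cast h10.symm

/-- The interval between a pole and its antipole is closed under taking neighbours, so by
connectedness it contains every vertex. -/
theorem sum_dist_eq (hG : IsBonnetMyersSharp G D) {x₀ : V} (hp : IsPole G x₀) (y : V) :
    ∑ v ∈ unitBall G y, (G.dist x₀ v : ℝ) =
      D + (D + 1 - D * curvatureInf G D) * G.dist x₀ y := by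
  obtain ⟨xL, -, hL⟩ := hp
  refine (hG.sum_dist_eq_of_mem_interval hL ?_).1
  obtain ⟨w⟩ := hG.connected.preconnected y x₀
  induction w with
  | nil => rw [SimpleGraph.dist_self, zero_add, SimpleGraph.dist_comm, hL]
  | cons h w ih =>
    exact (hG.sum_dist_eq_of_mem_interval hL (ih hL)).2 _ (mem_unitBall.2 (Or.inr h.symm))

theorem exists_isSharpFrom (hG : IsBonnetMyersSharp G D) {x₀ x₁ : V} (hp : IsPole G x₀)
    (h01 : G.Adj x₀ x₁) : ∃ b : ℤ, IsSharpFrom G x₀ D b := by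
  have h1 := hG.sum_dist_eq hp x₁
  rw [SimpleGraph.dist_eq_one_iff_adj.2 h01] at h1
  -- The constant is an integer because the identity at `x₁`, at distance 1, exhibits it as a sum of
  -- distances minus `D`.
  obtain ⟨b, hb⟩ : ∃ b : ℤ, (b : ℝ) = D + 1 - D * curvatureInf G D := by
    refine ⟨∑ v ∈ unitBall G x₁, (G.dist x₀ v : ℤ) - D, ?_⟩
    push_cast
    rw [h1]
    simp
  refine ⟨b, hG.connected, fun y => ?_, fun x y hxy h hh => ?_, fun y => ?_⟩
  · rw [card_unitBall_of_regular hG.regular]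
    push_cast
    rfl
  · have h2 := hG.sum_le hxy (h := fun v => (h v : ℝ)) fun p q hpq => by
      exact_mod_cast hh p q hpq
    rw [← hb] at h2
    exact_mod_cast h2
  · have h2 := hG.sum_dist_eq hp y
    rw [← hb] at h2
    exact_mod_cast h2

theorem cost_planOfMap (hc : G.Connected) (x : V) (T : V → V) :
    ((D : ℝ) + 1) * cost G (planOfMap G D x T) = ∑ v ∈ unitBall G x, (G.dist v (T v) : ℝ) := by
  classical
  have hpos : (0 : ℝ) < D + 1 := by positivity
  have h1 : ∀ v, ∑ z, (G.dist v z : ℝ) * planOfMap G D x T v z =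
      if v ∈ unitBall G x then (G.dist v (T v) : ℝ) * (1 / (D + 1)) else 0 := by
    intro v
    by_cases hv : v ∈ unitBall G x
    · simp [planOfMap, mem_ball_one_iff hc, hv]
    · simp [planOfMap, mem_ball_one_iff hc, hv]
  unfold cost
  simp only [h1, Finset.sum_ite_mem, Finset.univ_inter]
  rw [← Finset.sum_mul]
  field_simp

/-- Optimal transport maps along an edge pointing away from a pole move mass along geodesics
starting at the pole. -/
theorem dist_map_eq (hG : IsBonnetMyersSharp G D) {x₀ x y : V} (hp : IsPole G x₀)
    (hxy : G.Adj x y) (hd : G.dist x₀ y = G.dist x₀ x + 1) {T : V → V}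
    (hT : IsGoodOptimalTransportMap G D x y T) {v : V} (hv : v ∈ unitBall G x) :
    G.dist x₀ (T v) = G.dist x₀ v + G.dist v (T v) := by
  classical
  have h1 := hG.W1_le hxy
  rw [← hT.optimal.2, cost_planOfMap hG.connected] at h1
  have h2 := hG.sum_dist_eq hp y
  have h3 := hG.sum_dist_eq hp x
  have h4 : ∑ v ∈ unitBall G y, (G.dist x₀ v : ℝ) =
      ∑ v ∈ unitBall G x, (G.dist x₀ (T v) : ℝ) := by
    symm
    refine Finset.sum_bij (fun v _ => T v) ?_ ?_ ?_ ?_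
    · intro a ha
      exact (mem_ball_one_iff hG.connected).1
        (hT.bijOn.mapsTo ((mem_ball_one_iff hG.connected).2 ha))
    · intro a ha a' ha' haa
      exact hT.bijOn.injOn ((mem_ball_one_iff hG.connected).2 ha)
        ((mem_ball_one_iff hG.connected).2 ha') haa
    · intro c hc
      obtain ⟨a, ha, rfl⟩ := hT.bijOn.surjOn ((mem_ball_one_iff hG.connected).2 hc)
      exact ⟨a, (mem_ball_one_iff hG.connected).1 ha, rfl⟩
    · intro _ _
      rfl
  have h5 : ∀ v ∈ unitBall G x,
      (G.dist x₀ (T v) : ℝ) ≤ G.dist x₀ v + G.dist v (T v) := fun v _ => by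
    exact_mod_cast hG.connected.dist_triangle
  have h6 : ∑ v ∈ unitBall G x, ((G.dist x₀ v : ℝ) + G.dist v (T v)) =
      ∑ v ∈ unitBall G x, (G.dist x₀ v : ℝ) + ∑ v ∈ unitBall G x, (G.dist v (T v) : ℝ) :=
    Finset.sum_add_distrib
  rw [hd] at h2
  push_cast at h2
  have h7 := Finset.sum_le_sum h5
  -- The distance sum grows by `b` while the cost is at most `b`, so every triangle inequality in
  -- `h5` is an equality.
  have h8 := (Finset.sum_eq_sum_iff_of_le h5).1 (by linarith) v hv
  exact_mod_cast h8

end IsBonnetMyersSharp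

end Transport

end BonnetMyers

/-! ### Diameters of intervals. -/

namespace BonnetMyers

section Interval

variable {V : Type*} {G : SimpleGraph V}

theorem exists_adj_dist_add_one (hc : G.Connected) {x a : V} (hne : a ≠ x) :
    ∃ c, G.Adj c a ∧ G.dist x c + 1 = G.dist x a := by
  obtain ⟨p, hp⟩ := hc.exists_walk_length_eq_dist a x
  cases p with
  | nil => exact absurd rfl hne
  | @cons _ c _ h p =>
    refine ⟨c, h.symm, ?_⟩
    rw [SimpleGraph.Walk.length_cons] at hp
    have h1 := SimpleGraph.dist_le p
    have h2 := hc.dist_triangle (u := a) (v := c) (w := x)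
    rw [SimpleGraph.dist_eq_one_iff_adj.2 h] at h2
    rw [SimpleGraph.dist_comm (u := x), SimpleGraph.dist_comm (u := x)]
    omega

theorem interval_comm (x y : V) : interval G x y = interval G y x := by
  ext v
  simp only [interval, Set.mem_ofPred_eq]
  rw [SimpleGraph.dist_comm (u := x) (v := v), SimpleGraph.dist_comm (u := v) (v := y),
    SimpleGraph.dist_comm (u := x) (v := y), add_comm]

/-- A predecessor of `a` on a geodesic from `x` stays in the interval. Keeping `A` a variable lets
the lemma be used from either end of the same induced subgraph. -/
theorem exists_walk_induce_interval (hc : G.Connected) {x w : V} {A : Set V}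
    (hA : A = interval G x w) {a : V} (ha : a ∈ A) (hx : x ∈ A) :
    ∃ p : (G.induce A).Walk ⟨x, hx⟩ ⟨a, ha⟩, p.length = G.dist x a := by
  induction hn : G.dist x a generalizing a with
  | zero =>
    obtain rfl := hc.dist_eq_zero_iff.1 hn
    exact ⟨.nil, rfl⟩
  | succ n ih =>
    have hne : a ≠ x := by
      rintro rfl
      simp at hn
    obtain ⟨c, hca, hd⟩ := exists_adj_dist_add_one hc hne
    have hcA : c ∈ A := by
      rw [hA] at ha ⊢
      simp only [interval, Set.mem_ofPred_eq] at ha ⊢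
      have h1 := hc.dist_triangle (u := x) (v := c) (w := w)
      have h2 := hc.dist_triangle (u := c) (v := a) (w := w)
      rw [SimpleGraph.dist_eq_one_iff_adj.2 hca] at h2
      omega
    obtain ⟨p, hp⟩ := ih hcA (by omega)
    have hadj : (G.induce A).Adj ⟨c, hcA⟩ ⟨a, ha⟩ := hca
    exact ⟨p.concat hadj, by rw [SimpleGraph.Walk.length_concat, hp]⟩

theorem le_dist_induce {A : Set V} (hA : (G.induce A).Connected) (a c : A) :
    G.dist a c ≤ (G.induce A).dist a c := by
  obtain ⟨p, hp⟩ := hA.exists_walk_length_eq_dist a c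
  rw [← hp, ← SimpleGraph.Walk.length_map (SimpleGraph.Embedding.induce A).toHom p]
  exact SimpleGraph.dist_le _

/-- Two points of an interval that are as far apart as its end points are antipoles of each other
in the interval. -/
theorem areAntipolesIn_interval [Finite V] (hc : G.Connected) {x w a c : V}
    (ha : a ∈ interval G x w) (hcm : c ∈ interval G x w) (hac : a ≠ c)
    (hd : G.dist x w ≤ G.dist a c) : AreAntipolesIn G (interval G x w) a c := by
  have hx : x ∈ interval G x w := by simp [interval]
  have hw : w ∈ interval G x w := by simp [interval]
  set A := interval G x w with hA
  have h1 : ∀ v : A, ∃ p : (G.induce A).Walk ⟨x, hx⟩ v, p.length = G.dist x v :=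
    fun v => exists_walk_induce_interval hc hA v.2 hx
  have h2 : ∀ v : A, ∃ p : (G.induce A).Walk ⟨w, hw⟩ v, p.length = G.dist w v :=
    fun v => exists_walk_induce_interval hc (hA.trans (interval_comm x w)) v.2 hw
  have : Nonempty A := ⟨⟨x, hx⟩⟩
  have hconn : (G.induce A).Connected := by
    refine ⟨fun p q => ?_⟩
    obtain ⟨r, -⟩ := h1 p
    obtain ⟨s, -⟩ := h1 q
    exact ⟨r.reverse.append s⟩
  -- The walks from `p` to `q` through the two ends have total length `2 * G.dist x w`, so one of
  -- them has length at most `G.dist x w`.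
  have hle : ∀ p q : A, (G.induce A).dist p q ≤ G.dist x w := by
    intro p q
    obtain ⟨r, hr⟩ := h1 p
    obtain ⟨s, hs⟩ := h1 q
    obtain ⟨r', hr'⟩ := h2 p
    obtain ⟨s', hs'⟩ := h2 q
    have h3 := SimpleGraph.dist_le (r.reverse.append s)
    have h4 := SimpleGraph.dist_le (r'.reverse.append s')
    rw [SimpleGraph.Walk.length_append, SimpleGraph.Walk.length_reverse] at h3 h4
    have h5 : G.dist x p + G.dist p w = G.dist x w := p.2
    have h6 : G.dist x q + G.dist q w = G.dist x w := q.2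
    rw [SimpleGraph.dist_comm] at hr' hs'
    omega
  have hge := (le_dist_induce hconn ⟨a, ha⟩ ⟨c, hcm⟩)
  have hdiam := SimpleGraph.dist_le_diam (SimpleGraph.connected_iff_ediam_ne_top.1 hconn)
    (u := ⟨a, ha⟩) (v := ⟨c, hcm⟩)
  obtain ⟨p, q, hpq⟩ := (G.induce A).exists_dist_eq_diam
  have h3 := hle p q
  have h4 : (G.induce A).dist ⟨a, ha⟩ ⟨c, hcm⟩ = (G.induce A).diam := by
    simp only at hge
    omega
  refine ⟨ha, hcm, ⟨fun h => hac (congrArg Subtype.val h).symm, h4⟩,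
    ⟨fun h => hac (congrArg Subtype.val h), ?_⟩⟩
  rw [SimpleGraph.dist_comm, h4]

end Interval

end BonnetMyers

/-! ### The theorem. -/

theorem mainTheorem4 {V : Type*} [Fintype V] (G : SimpleGraph V) [DecidableRel G.Adj] (D : ℕ)
    (hG : BonnetMyers.IsBonnetMyersSharp G D)
    (x₀ x₁ x₂ : V) (hpole : BonnetMyers.IsPole G x₀)
    (h01 : G.Adj x₀ x₁) (h12 : G.Adj x₁ x₂) (h02 : G.dist x₀ x₂ = 2)
    (T₁ T₂ : V → V)
    (hT₁ : BonnetMyers.IsGoodOptimalTransportMap G D x₀ x₁ T₁)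
    (hT₂ : BonnetMyers.IsGoodOptimalTransportMap G D x₁ x₂ T₂)
    (u v w : V) (hu : u ∈ BonnetMyers.sphere G 1 x₀)
    (huv : T₁ u = v) (hvw : T₂ v = w)
    (hne_uv : u ≠ v) (hne_vw : v ≠ w) (hne_uw : u ≠ w) :
    w ∈ BonnetMyers.sphere G 3 x₀ ∧
      u ∈ BonnetMyers.interval G x₀ w ∧
      x₂ ∈ BonnetMyers.interval G x₀ w ∧
      G.dist u x₂ = 3 ∧
      BonnetMyers.AreAntipolesIn G (BonnetMyers.interval G x₀ w) u x₂ := by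
  open BonnetMyers in
  have hc := hG.connected
  have hmem : ∀ {x v : V}, v ∈ ball G 1 x ↔ v ∈ unitBall G x := mem_ball_one_iff hc
  have hu1 : G.dist x₀ u = 1 := hu
  have hx1 : G.dist x₀ x₁ = 1 := SimpleGraph.dist_eq_one_iff_adj.2 h01
  have hub : u ∈ ball G 1 x₀ := hu1.le
  have hvb : v ∈ ball G 1 x₁ := huv ▸ hT₁.bijOn.mapsTo hub
  have hwb : w ∈ ball G 1 x₂ := hvw ▸ hT₂.bijOn.mapsTo hvb
  have huv1 := hG.dist_map_eq hpole h01 (by simp [hx1]) hT₁ (hmem.1 hub)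
  have hvw1 := hG.dist_map_eq hpole h12 (by omega) hT₂ (hmem.1 hvb)
  rw [huv] at huv1
  rw [hvw] at hvw1
  have hpos1 := hc.pos_dist_of_ne hne_uv
  have hpos2 := hc.pos_dist_of_ne hne_vw
  have hvle : G.dist x₁ v ≤ 1 := hvb
  have hwle : G.dist x₂ w ≤ 1 := hwb
  have htri1 := hc.dist_triangle (u := x₀) (v := x₁) (w := v)
  have htri2 := hc.dist_triangle (u := x₀) (v := x₂) (w := w)
  -- Each transport step with distinct ends moves at least one level outwards, and the balls around
  -- `x₁` and `x₂` allow no more.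
  have hv2 : G.dist x₀ v = 2 := by omega
  have hw3 : G.dist x₀ w = 3 := by omega
  have huv' : G.Adj u v := SimpleGraph.dist_eq_one_iff_adj.1 (by omega)
  have hvw' : G.Adj v w := SimpleGraph.dist_eq_one_iff_adj.1 (by omega)
  have hx1v : G.Adj x₁ v := SimpleGraph.dist_eq_one_iff_adj.1 (by omega)
  have hx2w : G.Adj x₂ w := SimpleGraph.dist_eq_one_iff_adj.1 (by omega)
  have hux : u ∉ ball G 1 x₁ := fun h =>
    hne_uv.symm (huv ▸ (hT₁.fixed_iff u hub).2 ⟨hub, h⟩)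
  have hvx : v ∉ ball G 1 x₂ := fun h =>
    hne_vw.symm (hvw ▸ (hT₂.fixed_iff v hvb).2 ⟨hvb, h⟩)
  rw [hmem, mem_unitBall, not_or] at hux hvx
  obtain ⟨b, S⟩ := hG.exists_isSharpFrom hpole h01
  have h3 : 3 ≤ G.dist u x₂ := S.three_le_dist hx1 hu1 hv2 h02 hux.2 (Ne.symm hux.1) hx1v huv' h12
    (fun h => hvx.2 h.symm) hvx.1
  have huw : G.dist u w = 2 := by
    have h4 := hc.dist_triangle (u := u) (v := v) (w := w)
    have h5 := hc.dist_triangle (u := x₀) (v := u) (w := w)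
    omega
  have h2w := SimpleGraph.dist_eq_one_iff_adj.2 hx2w
  have hux2 : G.dist u x₂ = 3 := by
    have h4 := hc.dist_triangle (u := u) (v := w) (w := x₂)
    rw [SimpleGraph.dist_comm (u := w)] at h4
    omega
  have hui : u ∈ interval G x₀ w := by
    show G.dist x₀ u + G.dist u w = G.dist x₀ w
    omega
  have hxi : x₂ ∈ interval G x₀ w := by
    show G.dist x₀ x₂ + G.dist x₂ w = G.dist x₀ w
    omega
  refine ⟨hw3, hui, hxi, hux2, areAntipolesIn_interval hc hui hxi ?_ (by omega)⟩
  rintro rfl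
  simp at hux2
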